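/- Let $m\ge n$, $B,\Delta B\in\mathbb C^{m\times n}$, and $B(t)=B+t\,\Delta B$ for $t\in\mathbb R$. Let $k\ge 1$ and $r_1,\dots,r_k\ge 1$ with $r_1+\dots+r_k=n$. Suppose that for all $t\in\mathbb R$ $$B(t)=W(t)\begin{bmatrix}\Sigma(t)\\0\end{bmatrix}V(t)^H,\qquad \Sigma(t)=\operatorname{diag}(\Sigma_1(t),\dots,\Sigma_k(t)),\quad \Sigma_j(t)\in\mathbb C^{r_j\times r_j},$$ where $W(t)=[W_1(t),\dots,W_k(t),W_{k+1}(t)]\in\mathbb C^{m\times m}$ and $V(t)=[V_1(t),\dots,V_k(t)]\in\mathbb C^{n\times n}$ are unitary, $W_j(t)\in\mathbb C^{m\times r_j}$ and $V_j(t)\in\mathbb C^{n\times r_j}$ for $j\le k$, $W_{k+1}(t)\in\mathbb C^{m\times(m-n)}$, all these matrices are analytic functions of $t\in\mathbb R$ (the $\Sigma_j(t)$ need not be diagonal), and $$W_j(t)^H\dot W_j(t)=0\ (1\le j\le k+1),\qquad V_j(t)^H\dot V_j(t)=0\ (1\le j\le k).$$ Write $\sigma(M)$ for the set of singular values of a square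 matrix $M$, $\mathrm{Sing}^{\downarrow}(M)$ for the diagonal matrix of its singular values in nonincreasing order, $\|\cdot\|_2$ for the spectral norm and $\|\cdot\|_F$ for the Frobenius norm. Put $$\rho_1(t)=\min_{i\ne 1}\ \min_{\sigma\in\sigma(\Sigma_1(t)),\,\sigma'\in\sigma(\Sigma_i(t))}|\sigma-\sigma'|,\qquad \hat\rho_1(t)=\min\{\rho_1(t),\ \min\sigma(\Sigma_1(t))\},$$ $$\rho_{1,\min}=\min_{0\le t\le1}\rho_1(t),\qquad \hat\rho_{1,\min}=\min_{0\le t\le1}\hat\rho_1(t).$$ (If $k=1$, the minimum over the empty set is $\rho_1(t)=\infty$, and the conventions $\infty\cdot0=0$, $c/\infty=0$ and $\infty-c=\infty$ for finite $c$ are used.) Let $W_1=W_1(0)$, $\widetilde W_1=W_1(1)$, $V_1=V_1(0)$, $\widetilde V_1=V_1(1)$, $\Sigma_1=\Sigma_1(0)$, $\widetilde\Sigma_1=\Sigma_1(1)$. For matrices $U,\widetilde U$ of equal size with orthonormal columns let $\Theta(U,\widetilde U)=\arccos\big((U^H\widetilde U\widetilde U^HU)^{1/2}\big)$ be the canonical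 angle matrix. (i) If $\|\Delta B\|_2<\hat\rho_{1,\min}$, then $$2\|\mathrm{Sing}^{\downarrow}(\widetilde\Sigma_1)-\mathrm{Sing}^{\downarrow}(\Sigma_1)\|_F^2+\hat\rho_{1,\min}^2\|\sin\Theta(W_1,\widetilde W_1)\|_F^2+\rho_{1,\min}^2\|\sin\Theta(V_1,\widetilde V_1)\|_F^2\le\left(\frac{\hat\rho_{1,\min}}{\hat\rho_{1,\min}-\|\Delta B\|_2}\right)^2\left(\|\Delta B\,V_1\|_F^2+\|W_1^H\Delta B\|_F^2\right).$$ (ii) If $m=n$ and $\|\Delta B\|_2<\rho_{1,\min}$, then $$2\left(1-\frac{\|\Delta B\|_2}{\rho_{1,\min}}\right)^2\|\mathrm{Sing}^{\downarrow}(\widetilde\Sigma_1)-\mathrm{Sing}^{\downarrow}(\Sigma_1)\|_F^2+(\rho_{1,\min}-\|\Delta B\|_2)^2\left(\|\sin\Theta(W_1,\widetilde W_1)\|_F^2+\|\sin\Theta(V_1,\widetilde V_1)\|_F^2\right)\le\|\Delta B\,V_1\|_F^2+\|W_1^H\Delta B\|_F^2.$$ -/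

import Mathlib

open scoped Matrix ENNReal

noncomputable section

namespace CombinedBounds

/-- The Frobenius norm of a matrix, as an extended nonnegative real. It is always finite;
extended values only serve minima over an empty index set, see `gap`. -/
def frobNorm {𝕜 : Type*} [RCLike 𝕜] {m n : ℕ} (M : Matrix (Fin m) (Fin n) 𝕜) : ℝ≥0∞ :=
  ENNReal.ofReal (Matrix.frobeniusNormedAddCommGroup.toNorm.norm M)

/-- The spectral norm of a complex matrix (the operator norm between Euclidean spaces), as an
extended nonnegative real. It is always finite. -/
def specNorm {m n : ℕ} (M : Matrix (Fin m) (Fin n) ℂ) : ℝ≥0∞ :=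
  ENNReal.ofReal (Matrix.instL2OpNormedAddCommGroup.toNorm.norm M)

/-- The singular values of a complex square matrix, in nonincreasing order and repeated according
to multiplicity. -/
def singVal {r : ℕ} (M : Matrix (Fin r) (Fin r) ℂ) (i : Fin r) : ℝ :=
  M.toEuclideanLin.singularValues i

/-- The diagonal matrix of the singular values in nonincreasing order. -/
def Sing {r : ℕ} (M : Matrix (Fin r) (Fin r) ℂ) : Matrix (Fin r) (Fin r) ℝ :=
  Matrix.diagonal (singVal M)

/-- The matrix `Θ(U, U') = arccos ((Uᴴ U' U'ᴴ U) ^ (1/2))` of canonical angles between the ranges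
of two matrices with orthonormal columns (functions of Hermitian matrices). -/
def canonicalAngle {n r : ℕ} (U U' : Matrix (Fin n) (Fin r) ℂ) : Matrix (Fin r) (Fin r) ℂ :=
  cfc Real.arccos (cfc Real.sqrt (Uᴴ * U' * U'ᴴ * U))

/-- The matrix `sin Θ(U, U')`. -/
def sinTheta {n r : ℕ} (U U' : Matrix (Fin n) (Fin r) ℂ) : Matrix (Fin r) (Fin r) ℂ :=
  cfc Real.sin (canonicalAngle U U')

/-- Entrywise real analyticity on the whole real line of a matrix-valued function. -/
def IsAnalytic {m n : ℕ} (F : ℝ → Matrix (Fin m) (Fin n) ℂ) : Prop :=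
  ∀ a b, AnalyticOnNhd ℝ (fun t => F t a b) Set.univ

/-- The entrywise derivative of a matrix-valued function of a real variable. -/
def mderiv {m n : ℕ} (F : ℝ → Matrix (Fin m) (Fin n) ℂ) (t : ℝ) : Matrix (Fin m) (Fin n) ℂ :=
  Matrix.of fun a b => deriv (fun s => F s a b) t

/-- The block matrix `[V₁, …, V_k]`. -/
def blockRow {n k : ℕ} {r : Fin k → ℕ} (V : (j : Fin k) → Matrix (Fin n) (Fin (r j)) ℂ) :
    Matrix (Fin n) ((j : Fin k) × Fin (r j)) ℂ :=
  Matrix.of fun a x => V x.1 a x.2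

/-- The block matrix `[diag(S₁, …, S_k); 0]`, with `p` zero rows at the bottom. -/
def tallBlockDiag {k : ℕ} {r : Fin k → ℕ} (p : ℕ)
    (S : (j : Fin k) → Matrix (Fin (r j)) (Fin (r j)) ℂ) :
    Matrix (((j : Fin k) × Fin (r j)) ⊕ Fin p) ((j : Fin k) × Fin (r j)) ℂ :=
  Matrix.fromRows (Matrix.blockDiagonal' S) 0

/-- A matrix is unitary if its conjugate transpose is a two-sided inverse (so it is square, but its
rows and columns may be labelled by different index types). -/
def IsUnitary {α β : Type*} [Fintype α] [Fintype β] [DecidableEq α] [DecidableEq β]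
    (M : Matrix α β ℂ) : Prop :=
  Mᴴ * M = 1 ∧ M * Mᴴ = 1

/-- `B(t) = W(t) [Σ(t); 0] V(t)ᴴ` is an analytic block decomposition, for all real `t`, of a family
of `m × n` matrices (`n ≤ m`, `r₁ + ⋯ + r_k = n`), where `W = [W₁, …, W_k, W_{k+1}]` and
`V = [V₁, …, V_k]` are unitary and analytic, `Σ = diag(Σ₁, …, Σ_k)` is analytic, and the
blocks `Σ_j` are square of order `r_j` (not necessarily diagonal). Here `Wl` is `W_{k+1}`. -/
structure IsAnalyticBlockSVD {m n k : ℕ} (r : Fin k → ℕ) (B : ℝ → Matrix (Fin m) (Fin n) ℂ)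
    (W : (j : Fin k) → ℝ → Matrix (Fin m) (Fin (r j)) ℂ)
    (Wl : ℝ → Matrix (Fin m) (Fin (m - n)) ℂ)
    (V : (j : Fin k) → ℝ → Matrix (Fin n) (Fin (r j)) ℂ)
    (S : (j : Fin k) → ℝ → Matrix (Fin (r j)) (Fin (r j)) ℂ) : Prop where
  analytic_W : ∀ j, IsAnalytic (W j)
  analytic_Wl : IsAnalytic Wl
  analytic_V : ∀ j, IsAnalytic (V j)
  analytic_S : ∀ j, IsAnalytic (S j)
  unitary_W : ∀ t, IsUnitary (Matrix.fromCols (blockRow fun j => W j t) (Wl t))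
  unitary_V : ∀ t, IsUnitary (blockRow fun j => V j t)
  decomp : ∀ t, B t = Matrix.fromCols (blockRow fun j => W j t) (Wl t) *
    tallBlockDiag (m - n) (fun j => S j t) * (blockRow fun j => V j t)ᴴ

/-- The normalization `W_jᴴ Ẇ_j = 0` (`j ≤ k + 1`) and `V_jᴴ V̇_j = 0` (`j ≤ k`) for all `t`. -/
structure IsNormalized {m n k : ℕ} {r : Fin k → ℕ}
    (W : (j : Fin k) → ℝ → Matrix (Fin m) (Fin (r j)) ℂ)
    (Wl : ℝ → Matrix (Fin m) (Fin (m - n)) ℂ)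
    (V : (j : Fin k) → ℝ → Matrix (Fin n) (Fin (r j)) ℂ) : Prop where
  W_eq : ∀ j t, (W j t)ᴴ * mderiv (W j) t = 0
  Wl_eq : ∀ t, (Wl t)ᴴ * mderiv Wl t = 0
  V_eq : ∀ j t, (V j t)ᴴ * mderiv (V j) t = 0

/-- The least distance between a singular value of `M` and a singular value of `N`. -/
def singDist {p q : ℕ} (M : Matrix (Fin p) (Fin p) ℂ) (N : Matrix (Fin q) (Fin q) ℂ) : ℝ≥0∞ :=
  ⨅ (a : Fin p) (b : Fin q), ENNReal.ofReal |singVal M a - singVal N b|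

/-- `ρ_j`: the least distance between a singular value of `S_j` and a singular value of some other
block. If there is no other block, the minimum over the empty set is `∞`. -/
def gap {k : ℕ} {r : Fin k → ℕ} (S : (j : Fin k) → Matrix (Fin (r j)) (Fin (r j)) ℂ)
    (j : Fin k) : ℝ≥0∞ :=
  ⨅ (i : Fin k) (_ : i ≠ j), singDist (S j) (S i)

/-- The smallest singular value of a matrix. -/
def singMin {r : ℕ} (M : Matrix (Fin r) (Fin r) ℂ) : ℝ≥0∞ :=
  ⨅ a : Fin r, ENNReal.ofReal (singVal M a)

/-- `ρ_{j,min}`: the minimum of `ρ_j(t)` over `0 ≤ t ≤ 1`. -/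
def gapMin {k : ℕ} {r : Fin k → ℕ} (S : (j : Fin k) → ℝ → Matrix (Fin (r j)) (Fin (r j)) ℂ)
    (j : Fin k) : ℝ≥0∞ :=
  ⨅ t ∈ Set.Icc (0 : ℝ) 1, gap (fun i => S i t) j

/-- `ρ̂_{j,min}`: the minimum over `0 ≤ t ≤ 1` of `min (ρ_j(t), σ_{j,min}(t))`. -/
def gapHatMin {k : ℕ} {r : Fin k → ℕ} (S : (j : Fin k) → ℝ → Matrix (Fin (r j)) (Fin (r j)) ℂ)
    (j : Fin k) : ℝ≥0∞ :=
  ⨅ t ∈ Set.Icc (0 : ℝ) 1, min (gap (fun i => S i t) j) (singMin (S j t))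

end CombinedBounds

end

open CombinedBounds

/-! Write x = ‖ΔB‖₂, and let a ≤ b be lower bounds for the two gaps on [0, 1]. Consider the curves G
= [ΔB V₁; ΔBᴴ W₁] and H = [√2 Σ₁; a W₁; b V₁]. Differentiating B V₁ = W₁ Σ₁ and Bᴴ W₁ = V₁ Σ₁ᴴ and
testing with the blocks W_i, V_i gives coupled Sylvester equations for W_iᴴ Ẇ₁ and V_iᴴ V̇₁, whose
right-hand sides are blocks of G. Separated singular values bound their solutions, and the
normalization isolates Σ̇₁ in the block i = 1. Summing over blocks yields ‖Ḣ‖ ≤ ‖G‖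
(`sqNorm_mderiv_le`).

Moreover ‖Ġ‖ ≤ x ‖(Ẇ₁, V̇₁)‖ ≤ (x/a) ‖Ḣ‖ ≤ (x/a) ‖G‖, so G cannot grow much, and (1 - x/a) ‖H(1) -
H(0)‖ ≤ ‖G(0)‖ (`one_sub_mul_norm_sub_le`). The increment of H controls the quantities in the
theorem: Mirsky's inequality (`sqNorm_Sing_sub_le`) handles singular values, and
`sqNorm_sinTheta_le` handles angles.

Part (i) takes a, b to be the two minimal gaps. In part (ii) the block W_{k+1} is empty, so a = b is
allowed. An infinite gap is reached by taking b arbitrarily large. -/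

/-! ### Squared Frobenius norm and unitary invariance. -/

/-- The squared Frobenius norm, as a real number. -/
def sqNorm {𝕜 α β : Type*} [RCLike 𝕜] [Fintype α] [Fintype β] (M : Matrix α β 𝕜) : ℝ :=
  ∑ i, ∑ j, ‖M i j‖ ^ 2

theorem sqNorm_nonneg {𝕜 α β : Type*} [RCLike 𝕜] [Fintype α] [Fintype β] (M : Matrix α β 𝕜) :
    0 ≤ sqNorm M :=
  Finset.sum_nonneg fun _ _ => Finset.sum_nonneg fun _ _ => by positivity

theorem frobNorm_sq {𝕜 : Type*} [RCLike 𝕜] {m n : ℕ} (M : Matrix (Fin m) (Fin n) 𝕜) :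
    frobNorm M ^ 2 = ENNReal.ofReal (sqNorm M) := by
  unfold frobNorm
  let _ := Matrix.frobeniusNormedAddCommGroup (m := Fin m) (n := Fin n) (α := 𝕜)
  rw [← ENNReal.ofReal_pow (norm_nonneg M)]
  congr 1
  rw [Matrix.frobenius_norm_def, ← Real.sqrt_eq_rpow, Real.sq_sqrt]
  · simp [sqNorm]
  · positivity

theorem sqNorm_conjTranspose {α β : Type*} [Fintype α] [Fintype β] (M : Matrix α β ℂ) :
    sqNorm Mᴴ = sqNorm M := by
  simp only [sqNorm, Matrix.conjTranspose_apply, norm_star]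
  exact Finset.sum_comm

theorem ofReal_sqNorm {α β : Type*} [Fintype α] [Fintype β] (M : Matrix α β ℂ) :
    ((sqNorm M : ℝ) : ℂ) = (Mᴴ * M).trace := by
  rw [← sqNorm_conjTranspose]
  simp [sqNorm, Matrix.trace, Matrix.mul_apply, ← Complex.conj_mul']

theorem sqNorm_isometry_mul {α β γ : Type*} [Fintype α] [Fintype β] [Fintype γ] [DecidableEq β]
    {U : Matrix α β ℂ} (hU : Uᴴ * U = 1) (M : Matrix β γ ℂ) : sqNorm (U * M) = sqNorm M := by
  apply Complex.ofReal_injective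
  rw [ofReal_sqNorm, ofReal_sqNorm, Matrix.conjTranspose_mul, Matrix.mul_assoc,
    ← Matrix.mul_assoc Uᴴ, hU, Matrix.one_mul]

theorem sqNorm_mul_coisometry {α β γ : Type*} [Fintype α] [Fintype β] [Fintype γ] [DecidableEq β]
    {U : Matrix β α ℂ} (hU : U * Uᴴ = 1) (M : Matrix γ β ℂ) : sqNorm (M * U) = sqNorm M := by
  rw [← sqNorm_conjTranspose, Matrix.conjTranspose_mul, sqNorm_isometry_mul (by simpa using hU),
    sqNorm_conjTranspose]

theorem sqNorm_fromRows {α β γ : Type*} [Fintype α] [Fintype β] [Fintype γ]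
    (M : Matrix α γ ℂ) (N : Matrix β γ ℂ) :
    sqNorm (Matrix.fromRows M N) = sqNorm M + sqNorm N := by
  simp [sqNorm]

/-! ### Two scalar inequalities. -/

/-- The difference of the two sides is exactly 2xy‖k - l‖². This is the entrywise form of the
Sylvester bound once both coefficient blocks are diagonal. -/
theorem norm_sq_wedin (x y : ℝ) (hx : 0 ≤ x) (hy : 0 ≤ y) (k l : ℂ) :
    (x - y) ^ 2 * (‖k‖ ^ 2 + ‖l‖ ^ 2) ≤ ‖k * x - y * l‖ ^ 2 + ‖l * x - y * k‖ ^ 2 := by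
  have h : ‖k * x - y * l‖ ^ 2 + ‖l * x - y * k‖ ^ 2 =
      (x - y) ^ 2 * (‖k‖ ^ 2 + ‖l‖ ^ 2) + 2 * (x * y) * ‖k - l‖ ^ 2 := by
    simp only [Complex.sq_norm, Complex.normSq_apply, Complex.sub_re, Complex.sub_im,
      Complex.mul_re, Complex.mul_im, Complex.ofReal_re, Complex.ofReal_im]
    ring
  rw [h]
  have : 0 ≤ 2 * (x * y) * ‖k - l‖ ^ 2 := by positivity
  linarith

/-- The cross term 2 Re(k l̄) equals ‖k‖² + ‖l‖² - ‖k - l‖². Dropping the last square leaves only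
squared moduli, to which double stochasticity applies. -/
theorem norm_sq_mirsky (x y : ℝ) (hx : 0 ≤ x) (hy : 0 ≤ y) (k l : ℂ) :
    x ^ 2 * ‖l‖ ^ 2 + y ^ 2 * ‖k‖ ^ 2 - x * y * ‖k‖ ^ 2 - x * y * ‖l‖ ^ 2 ≤
      ‖x * l - k * y‖ ^ 2 := by
  have h : ‖x * l - k * y‖ ^ 2 = x ^ 2 * ‖l‖ ^ 2 + y ^ 2 * ‖k‖ ^ 2 - x * y * ‖k‖ ^ 2 -
      x * y * ‖l‖ ^ 2 + x * y * ‖k - l‖ ^ 2 := by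
    simp only [Complex.sq_norm, Complex.normSq_apply, Complex.sub_re, Complex.sub_im,
      Complex.mul_re, Complex.mul_im, Complex.ofReal_re, Complex.ofReal_im]
    ring
  rw [h]
  have : 0 ≤ x * y * ‖k - l‖ ^ 2 := by positivity
  linarith

/-! ### Singular value decomposition of square matrices. -/

theorem singVal_nonneg {r : ℕ} (M : Matrix (Fin r) (Fin r) ℂ) (i : Fin r) : 0 ≤ singVal M i :=
  LinearMap.singularValues_nonneg _ _

theorem singVal_antitone {r : ℕ} (M : Matrix (Fin r) (Fin r) ℂ) : Antitone (singVal M) :=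
  fun _ _ h => LinearMap.singularValues_antitone _ h

/-- The matrix whose columns are the vectors of an orthonormal basis is unitary. -/
theorem isUnitary_of_orthonormalBasis {r : ℕ}
    (b : OrthonormalBasis (Fin r) ℂ (EuclideanSpace ℂ (Fin r))) :
    IsUnitary (Matrix.of fun a i => b i a : Matrix (Fin r) (Fin r) ℂ) := by
  have h : (Matrix.of fun a i => b i a : Matrix (Fin r) (Fin r) ℂ)ᴴ *
      (Matrix.of fun a i => b i a : Matrix (Fin r) (Fin r) ℂ) = 1 := by
    ext i j
    have := orthonormal_iff_ite.1 b.orthonormal i j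
    rw [PiLp.inner_apply] at this
    simp only [Matrix.mul_apply, Matrix.conjTranspose_apply, Matrix.of_apply, Matrix.one_apply]
    rw [← this]
    simp [mul_comm]
  exact ⟨h, mul_eq_one_comm.1 h⟩

/-- Singular value decomposition of a square matrix. -/
theorem exists_svd {r : ℕ} (M : Matrix (Fin r) (Fin r) ℂ) :
    ∃ P Q : Matrix (Fin r) (Fin r) ℂ, IsUnitary P ∧ IsUnitary Q ∧
      M = P * Matrix.diagonal (fun i => (singVal M i : ℂ)) * Qᴴ := by
  set T := M.toEuclideanLin with hT
  have hfin : Module.finrank ℂ (EuclideanSpace ℂ (Fin r)) = r := by simp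
  set b := T.isSymmetric_adjoint_comp_self.eigenvectorBasis hfin with hb
  have hinner : ∀ i j, inner ℂ (T (b i)) (T (b j)) =
      if i = j then ((singVal M i : ℂ)) ^ 2 else 0 := by
    intro i j
    have h1 := T.isSymmetric_adjoint_comp_self.apply_eigenvectorBasis hfin j
    rw [← LinearMap.adjoint_inner_right]
    rw [← hb] at h1
    simp only [LinearMap.comp_apply] at h1
    rw [h1, inner_smul_right, orthonormal_iff_ite.1 b.orthonormal i j,
      ← T.sq_singularValues_fin hfin j]
    split_ifs with h
    · subst h; simp [singVal, hT]
    · simp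
  -- The left singular vectors are the normalized images of the right ones. Where the singular value
  -- vanishes, any orthonormal completion will do, since there the image is zero.
  have hv : Orthonormal ℂ (Set.domRestrict {i : Fin r | singVal M i ≠ 0}
      (fun i => ((singVal M i : ℂ))⁻¹ • T (b i))) := by
    rw [orthonormal_iff_ite]
    rintro ⟨i, hi⟩ ⟨j, hj⟩
    have hi' : (singVal M i : ℂ) ≠ 0 := by exact_mod_cast hi
    simp only [Set.domRestrict_apply, inner_smul_left, inner_smul_right, hinner, Subtype.mk.injEq]
    split_ifs with h
    · subst h
      simp
      field_simp
    · simp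
  obtain ⟨c, hc⟩ := hv.exists_orthonormalBasis_extension_of_card_eq (by simp)
  have hTb : ∀ i, T (b i) = (singVal M i : ℂ) • c i := by
    intro i
    by_cases h : singVal M i = 0
    · have := hinner i i
      simp only [h, if_true] at this
      rw [h]
      simpa using this
    · have h' : (singVal M i : ℂ) ≠ 0 := by exact_mod_cast h
      rw [hc i h, smul_inv_smul₀ h']
  refine ⟨Matrix.of fun a i => c i a, Matrix.of fun a i => b i a,
    isUnitary_of_orthonormalBasis c, isUnitary_of_orthonormalBasis b, ?_⟩
  have h : M * (Matrix.of fun a i => b i a : Matrix (Fin r) (Fin r) ℂ) =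
      (Matrix.of fun a i => c i a : Matrix (Fin r) (Fin r) ℂ) *
        Matrix.diagonal (fun i => (singVal M i : ℂ)) := by
    ext a i
    have := congrArg (fun v : EuclideanSpace ℂ (Fin r) => v a) (hTb i)
    simp only [hT, Matrix.toLpLin_apply, PiLp.smul_apply, smul_eq_mul] at this
    rw [Matrix.mul_diagonal, Matrix.of_apply, mul_comm, ← this]
    rfl
  rw [← h, Matrix.mul_assoc, (isUnitary_of_orthonormalBasis b).2, Matrix.mul_one]

/-! ### Unitary matrices and Mirsky's inequality. -/

theorem CombinedBounds.IsUnitary.conjTranspose {α β : Type*} [Fintype α] [Fintype β] [DecidableEq α]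
    [DecidableEq β] {M : Matrix α β ℂ} (h : IsUnitary M) : IsUnitary Mᴴ :=
  ⟨by simpa using h.2, by simpa using h.1⟩

theorem CombinedBounds.IsUnitary.mul {α β γ : Type*} [Fintype α] [Fintype β] [Fintype γ]
    [DecidableEq α] [DecidableEq β] [DecidableEq γ] {M : Matrix α β ℂ} {N : Matrix β γ ℂ} (h : IsUnitary M)
    (h' : IsUnitary N) : IsUnitary (M * N) := by
  constructor
  · rw [Matrix.conjTranspose_mul, Matrix.mul_assoc, ← Matrix.mul_assoc Mᴴ, h.1, Matrix.one_mul,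
      h'.1]
  · rw [Matrix.conjTranspose_mul, Matrix.mul_assoc, ← Matrix.mul_assoc N, h'.2, Matrix.one_mul,
      h.2]

theorem CombinedBounds.IsUnitary.sqNorm_mul_mul {α β γ δ : Type*} [Fintype α] [Fintype β] [Fintype γ]
    [Fintype δ] [DecidableEq α] [DecidableEq β] [DecidableEq γ] [DecidableEq δ]
    {P : Matrix α β ℂ} {Q : Matrix γ δ ℂ} (hP : IsUnitary P) (hQ : IsUnitary Q)
    (M : Matrix β γ ℂ) : sqNorm (P * M * Q) = sqNorm M := by
  rw [sqNorm_mul_coisometry hQ.2, sqNorm_isometry_mul hP.1]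

theorem CombinedBounds.IsUnitary.sqNorm_entries_mem_doublyStochastic {r : ℕ}
    {X : Matrix (Fin r) (Fin r) ℂ}
    (hX : IsUnitary X) :
    (Matrix.of fun i j => ‖X i j‖ ^ 2) ∈ doublyStochastic ℝ (Fin r) := by
  rw [mem_doublyStochastic_iff_sum]
  refine ⟨fun i j => by simp only [Matrix.of_apply]; positivity, fun i => ?_, fun j => ?_⟩
  · have := congrFun (congrFun hX.2 i) i
    simp only [Matrix.mul_apply, Matrix.conjTranspose_apply, Matrix.one_apply_eq] at this
    apply Complex.ofReal_injective
    simpa [← Complex.mul_conj'] using this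
  · have := congrFun (congrFun hX.1 j) j
    simp only [Matrix.mul_apply, Matrix.conjTranspose_apply, Matrix.one_apply_eq] at this
    apply Complex.ofReal_injective
    simpa [← Complex.conj_mul'] using this

/-- A bilinear form given by a doubly stochastic matrix is at most the inner product of similarly
ordered families. -/
theorem Monovary.sum_mul_doublyStochastic_le {ι : Type*} [Fintype ι] [DecidableEq ι] {f g : ι → ℝ}
    (hfg : Monovary f g) {D : Matrix ι ι ℝ} (hD : D ∈ doublyStochastic ℝ ι) :
    ∑ i, ∑ j, f i * g j * D i j ≤ ∑ i, f i * g i := by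
  -- Birkhoff's theorem reduces the claim to permutation matrices, where it is the rearrangement
  -- inequality.
  obtain ⟨w, hw0, hw1, hw⟩ := exists_eq_sum_perm_of_mem_doublyStochastic hD
  calc ∑ i, ∑ j, f i * g j * D i j
      = ∑ i, ∑ j, ∑ σ : Equiv.Perm ι, w σ * (f i * g j * (σ.permMatrix ℝ) i j) := by
        refine Finset.sum_congr rfl fun i _ => Finset.sum_congr rfl fun j _ => ?_
        rw [← hw, Matrix.sum_apply, Finset.mul_sum]
        refine Finset.sum_congr rfl fun σ _ => ?_
        rw [Matrix.smul_apply, smul_eq_mul]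
        ring
    _ = ∑ σ : Equiv.Perm ι, w σ * ∑ i, f i * g (σ i) := by
        simp_rw [Finset.mul_sum]
        rw [Finset.sum_comm' (t' := Finset.univ) (s' := fun _ => Finset.univ) (by simp)]
        rw [Finset.sum_comm]
        conv_lhs => enter [2, i]; rw [Finset.sum_comm]
        rw [Finset.sum_comm]
        refine Finset.sum_congr rfl fun σ _ => Finset.sum_congr rfl fun i _ => ?_
        simp [Equiv.Perm.permMatrix, PEquiv.toMatrix_apply]
    _ ≤ ∑ σ : Equiv.Perm ι, w σ * ∑ i, f i * g i :=
        Finset.sum_le_sum fun σ _ =>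
          mul_le_mul_of_nonneg_left hfg.sum_mul_comp_perm_le_sum_mul (hw0 σ)
    _ = ∑ i, f i * g i := by rw [← Finset.sum_mul, hw1, one_mul]

/-- Mirsky's theorem for the Frobenius norm. -/
theorem sqNorm_Sing_sub_le {r : ℕ} (A B : Matrix (Fin r) (Fin r) ℂ) :
    sqNorm (Sing A - Sing B) ≤ sqNorm (A - B) := by
  obtain ⟨P, Q, hP, hQ, hA⟩ := exists_svd A
  obtain ⟨P', Q', hP', hQ', hB⟩ := exists_svd B
  set f := singVal A with hf
  set g := singVal B with hg
  set X := Pᴴ * P' with hX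
  set Y := Qᴴ * Q' with hY
  have hXu : IsUnitary X := hP.conjTranspose.mul hP'
  have hYu : IsUnitary Y := hQ.conjTranspose.mul hQ'
  have key : Pᴴ * (A - B) * Q' = Matrix.diagonal (fun i => (f i : ℂ)) * Y -
      X * Matrix.diagonal (fun i => (g i : ℂ)) := by
    have h1 : Pᴴ * A = Matrix.diagonal (fun i => (f i : ℂ)) * Qᴴ := by
      rw [hA, Matrix.mul_assoc, ← Matrix.mul_assoc, hP.1, Matrix.one_mul]
    have h2 : B * Q' = P' * Matrix.diagonal (fun i => (g i : ℂ)) := by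
      rw [hB, Matrix.mul_assoc, hQ'.1, Matrix.mul_one]
    rw [Matrix.mul_sub, Matrix.sub_mul, h1, Matrix.mul_assoc Pᴴ, h2, hX, hY, Matrix.mul_assoc,
      Matrix.mul_assoc]
  have hmono : Monovary f g := (singVal_antitone A).monovary (singVal_antitone B)
  have hdX := hXu.sqNorm_entries_mem_doublyStochastic
  have hdY := hYu.sqNorm_entries_mem_doublyStochastic
  have eX := hmono.sum_mul_doublyStochastic_le hdX
  have eY := hmono.sum_mul_doublyStochastic_le hdY
  simp only [Matrix.of_apply] at eX eY
  have rY := fun i => sum_row_of_mem_doublyStochastic hdY i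
  have cX := fun j => sum_col_of_mem_doublyStochastic hdX j
  simp only [Matrix.of_apply] at rY cX
  have e1 : ∑ i, ∑ j, f i ^ 2 * ‖Y i j‖ ^ 2 = ∑ i, f i ^ 2 := by
    refine Finset.sum_congr rfl fun i _ => ?_
    rw [← Finset.mul_sum, rY, mul_one]
  have e2 : ∑ i, ∑ j, g j ^ 2 * ‖X i j‖ ^ 2 = ∑ i, g i ^ 2 := by
    rw [Finset.sum_comm]
    refine Finset.sum_congr rfl fun i _ => ?_
    rw [← Finset.mul_sum, cX, mul_one]
  have lhs : sqNorm (Sing A - Sing B) = ∑ i, (f i ^ 2 + g i ^ 2 - 2 * (f i * g i)) := by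
    unfold sqNorm Sing
    refine Finset.sum_congr rfl fun i _ => ?_
    rw [Matrix.diagonal_sub, Finset.sum_eq_single i]
    · rw [Matrix.diagonal_apply_eq, Real.norm_eq_abs, sq_abs]
      ring
    · intro j _ hj
      rw [Matrix.diagonal_apply_ne _ hj.symm]
      simp
    · simp
  rw [← hP.conjTranspose.sqNorm_mul_mul hQ' (A - B), key, lhs]
  -- The square terms sum to ∑ f² + ∑ g² by the row sums of Y and the column sums of X. Each of the
  -- two bilinear terms is at most ∑ f g.
  have rhs : ∑ i, ∑ j, (f i ^ 2 * ‖Y i j‖ ^ 2 + g j ^ 2 * ‖X i j‖ ^ 2 - f i * g j * ‖X i j‖ ^ 2 -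
      f i * g j * ‖Y i j‖ ^ 2) ≤ sqNorm (Matrix.diagonal (fun i => (f i : ℂ)) * Y -
      X * Matrix.diagonal (fun i => (g i : ℂ))) := by
    refine Finset.sum_le_sum fun i _ => Finset.sum_le_sum fun j _ => ?_
    rw [Matrix.sub_apply, Matrix.diagonal_mul, Matrix.mul_diagonal]
    exact norm_sq_mirsky _ _ (singVal_nonneg A i) (singVal_nonneg B j) _ _
  refine le_trans ?_ rhs
  simp only [Finset.sum_sub_distrib, Finset.sum_add_distrib, e2, ← Finset.mul_sum] at *
  linarith

/-! ### Sylvester-type lower bounds and products. -/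

/-- A lower bound for a coupled pair of Sylvester equations with separated singular values. -/
theorem le_sqNorm_sylvester {p q : ℕ} (S : Matrix (Fin p) (Fin p) ℂ)
    (S' : Matrix (Fin q) (Fin q) ℂ) (K L : Matrix (Fin q) (Fin p) ℂ) {ρ : ℝ} (hρ : 0 ≤ ρ)
    (h : ∀ a b, ρ ≤ |singVal S a - singVal S' b|) :
    ρ ^ 2 * (sqNorm K + sqNorm L) ≤
      sqNorm (K * S - S' * L) + sqNorm (L * Sᴴ - S'ᴴ * K) := by
  obtain ⟨P, Q, hP, hQ, hS⟩ := exists_svd S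
  obtain ⟨P', Q', hP', hQ', hS'⟩ := exists_svd S'
  set D := Matrix.diagonal (fun i => (singVal S i : ℂ)) with hD
  set D' := Matrix.diagonal (fun i => (singVal S' i : ℂ)) with hD'
  have hDs : Dᴴ = D := by
    rw [hD, Matrix.diagonal_conjTranspose]; congr 1; ext i; simp
  have hDs' : D'ᴴ = D' := by
    rw [hD', Matrix.diagonal_conjTranspose]; congr 1; ext i; simp
  -- K is expressed in the left singular bases and L in the right ones. Both equations then have
  -- diagonal coefficients, and entry (i, j) of K couples only with entry (i, j) of L.
  set K' := P'ᴴ * K * P with hK'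
  set L' := Q'ᴴ * L * Q with hL'
  have e1 : P'ᴴ * (K * S - S' * L) * Q = K' * D - D' * L' := by
    have h1 : S * Q = P * D := by rw [hS, Matrix.mul_assoc, hQ.1, Matrix.mul_one]
    have h2 : P'ᴴ * S' = D' * Q'ᴴ := by
      rw [hS', Matrix.mul_assoc, ← Matrix.mul_assoc, hP'.1, Matrix.one_mul]
    calc P'ᴴ * (K * S - S' * L) * Q = P'ᴴ * K * (S * Q) - P'ᴴ * S' * L * Q := by
          simp only [Matrix.mul_sub, Matrix.sub_mul, Matrix.mul_assoc]
      _ = _ := by rw [h1, h2]; simp only [hK', hL', Matrix.mul_assoc]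
  have e2 : Q'ᴴ * (L * Sᴴ - S'ᴴ * K) * P = L' * D - D' * K' := by
    have h1 : Sᴴ * P = Q * D := by
      rw [hS]
      simp only [Matrix.conjTranspose_mul, Matrix.conjTranspose_conjTranspose, hDs,
        Matrix.mul_assoc, hP.1, Matrix.mul_one]
    have h2 : Q'ᴴ * S'ᴴ = D' * P'ᴴ := by
      rw [hS']
      simp only [Matrix.conjTranspose_mul, Matrix.conjTranspose_conjTranspose, hDs']
      rw [← Matrix.mul_assoc, hQ'.1, Matrix.one_mul]
    calc Q'ᴴ * (L * Sᴴ - S'ᴴ * K) * P = Q'ᴴ * L * (Sᴴ * P) - Q'ᴴ * S'ᴴ * K * P := by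
          simp only [Matrix.mul_sub, Matrix.sub_mul, Matrix.mul_assoc]
      _ = _ := by rw [h1, h2]; simp only [hK', hL', Matrix.mul_assoc]
  rw [← hP'.conjTranspose.sqNorm_mul_mul hQ (K * S - S' * L),
    ← hQ'.conjTranspose.sqNorm_mul_mul hP (L * Sᴴ - S'ᴴ * K), e1, e2,
    ← hP'.conjTranspose.sqNorm_mul_mul hP K, ← hQ'.conjTranspose.sqNorm_mul_mul hQ L, ← hK', ← hL']
  simp only [sqNorm, ← Finset.sum_add_distrib, Finset.mul_sum]
  refine Finset.sum_le_sum fun i _ => Finset.sum_le_sum fun j _ => ?_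
  simp only [Matrix.sub_apply, hD, hD', Matrix.diagonal_mul, Matrix.mul_diagonal]
  refine le_trans ?_ (norm_sq_wedin _ _ (singVal_nonneg S j) (singVal_nonneg S' i) _ _)
  refine mul_le_mul_of_nonneg_right ?_ (by positivity)
  rw [← sq_abs (singVal S j - _)]
  exact pow_le_pow_left₀ hρ (h j i) 2

theorem le_sqNorm_mul {p q : ℕ} (S : Matrix (Fin p) (Fin p) ℂ) (K : Matrix (Fin q) (Fin p) ℂ)
    {ρ : ℝ} (hρ : 0 ≤ ρ) (h : ∀ a, ρ ≤ singVal S a) :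
    ρ ^ 2 * sqNorm K ≤ sqNorm (K * S) := by
  obtain ⟨P, Q, hP, hQ, hS⟩ := exists_svd S
  rw [← sqNorm_mul_coisometry hP.2 K, ← sqNorm_mul_coisometry hQ.2 (K * S)]
  have h1 : K * S * Q = K * P * Matrix.diagonal (fun i => (singVal S i : ℂ)) := by
    conv_lhs => rw [hS]
    simp only [Matrix.mul_assoc, hQ.1, Matrix.mul_one]
  rw [h1]
  simp only [sqNorm, Finset.mul_sum]
  refine Finset.sum_le_sum fun i _ => Finset.sum_le_sum fun j _ => ?_
  rw [Matrix.mul_diagonal, norm_mul, mul_pow, mul_comm]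
  refine mul_le_mul_of_nonneg_left ?_ (by positivity)
  rw [Complex.norm_real, Real.norm_eq_abs, abs_of_nonneg (singVal_nonneg S j)]
  exact pow_le_pow_left₀ hρ (h j) 2

/-- The Frobenius norm of a product is at most the spectral norm of the first factor times the
Frobenius norm of the second. -/
theorem sqNorm_mul_le {m n p : ℕ} (A : Matrix (Fin m) (Fin n) ℂ) (X : Matrix (Fin n) (Fin p) ℂ) :
    sqNorm (A * X) ≤ (Matrix.instL2OpNormedAddCommGroup.toNorm.norm A) ^ 2 * sqNorm X := by
  let _ := Matrix.instL2OpNormedAddCommGroup (m := Fin m) (n := Fin n) (𝕜 := ℂ)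
  unfold sqNorm
  -- Summing over columns first reduces the bound to the operator norm estimate for each column of
  -- X.
  rw [Finset.sum_comm, Finset.sum_comm (s := Finset.univ (α := Fin n)), Finset.mul_sum]
  refine Finset.sum_le_sum fun j _ => ?_
  have h := A.l2_opNorm_mulVec (WithLp.toLp 2 fun i => X i j)
  have h2 := pow_le_pow_left₀ (norm_nonneg _) h 2
  rw [mul_pow, EuclideanSpace.norm_sq_eq, EuclideanSpace.norm_sq_eq] at h2
  exact h2

/-! ### Canonical angles. -/

theorem sin_arccos_sqrt_sq {x : ℝ} (h0 : 0 ≤ x) (h1 : x ≤ 1) :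
    Real.sin (Real.arccos (Real.sqrt x)) ^ 2 = 1 - x := by
  rw [Real.sin_arccos, Real.sq_sqrt h0, Real.sq_sqrt (by linarith)]

open scoped ComplexOrder in
/-- The squared sines of the canonical angles are the eigenvalues of `1 - Uᴴ U' U'ᴴ U`. -/
theorem sinTheta_conjTranspose_mul_self {n r : ℕ} {U U' : Matrix (Fin n) (Fin r) ℂ}
    (hU : Uᴴ * U = 1) (hU' : U'ᴴ * U' = 1) :
    (sinTheta U U')ᴴ * sinTheta U U' = 1 - Uᴴ * U' * U'ᴴ * U := by
  set X := Uᴴ * U' * U'ᴴ * U with hX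
  have hXf : X = (U'ᴴ * U)ᴴ * (U'ᴴ * U) := by
    simp only [hX, Matrix.conjTranspose_mul, Matrix.conjTranspose_conjTranspose, Matrix.mul_assoc]
  have hsa : IsSelfAdjoint X := by
    rw [hXf]; exact Matrix.isHermitian_conjTranspose_mul_self _
  have hpos : X.PosSemidef := by
    rw [hXf]; exact Matrix.posSemidef_conjTranspose_mul_self _
  have hpos' : (1 - X).PosSemidef := by
    -- 1 - X is the Gram matrix of the component of U orthogonal to the range of U'. Hence the
    -- spectrum of X lies in [0, 1], where sin² ∘ arccos ∘ √ is 1 - x.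
    have : 1 - X = (U - U' * U'ᴴ * U)ᴴ * (U - U' * U'ᴴ * U) := by
      have h3 : U'ᴴ * (U' * (U'ᴴ * U)) = U'ᴴ * U := by
        rw [← Matrix.mul_assoc, hU', Matrix.one_mul]
      simp only [Matrix.conjTranspose_sub, Matrix.conjTranspose_mul,
        Matrix.conjTranspose_conjTranspose, Matrix.sub_mul, Matrix.mul_sub, Matrix.mul_assoc, hU,
        h3, hX]
      abel
    rw [this]; exact Matrix.posSemidef_conjTranspose_mul_self _
  have hspec : ∀ x ∈ spectrum ℝ X, 0 ≤ x ∧ x ≤ 1 := by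
    intro x hx
    refine ⟨Complex.zero_le_real.1
      ((Matrix.posSemidef_iff_isHermitian_and_spectrum_nonneg.1 hpos).2 hx), ?_⟩
    have h1 : 1 - x ∈ spectrum ℝ (1 - X) := by
      have := spectrum.singleton_sub_eq (R := ℝ) X 1
      rw [map_one] at this
      rw [← this]
      exact ⟨1, rfl, x, hx, rfl⟩
    have := (Matrix.posSemidef_iff_isHermitian_and_spectrum_nonneg.1 hpos').2 h1
    have : (0 : ℝ) ≤ 1 - x := Complex.zero_le_real.1 this
    linarith
  have hs : sinTheta U U' = cfc (fun x => Real.sin (Real.arccos (Real.sqrt x))) X := by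
    unfold sinTheta canonicalAngle
    rw [← hX, cfc_comp' (fun y => Real.sin (Real.arccos y)) Real.sqrt X
      (Real.continuous_sin.comp Real.continuous_arccos).continuousOn
      Real.continuous_sqrt.continuousOn hsa,
      cfc_comp' Real.sin Real.arccos (cfc Real.sqrt X) Real.continuous_sin.continuousOn
      Real.continuous_arccos.continuousOn (cfc_predicate _ X)]
  have hh : IsSelfAdjoint (sinTheta U U') := by rw [hs]; exact cfc_predicate _ X
  have hh' : (sinTheta U U')ᴴ = sinTheta U U' := hh
  have hcont : Continuous fun x => Real.sin (Real.arccos (Real.sqrt x)) :=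
    Real.continuous_sin.comp (Real.continuous_arccos.comp Real.continuous_sqrt)
  rw [hh', hs, ← cfc_mul _ _ X hcont.continuousOn hcont.continuousOn]
  rw [cfc_congr (g := fun x => 1 - x)]
  · rw [cfc_sub (fun _ => (1 : ℝ)) (fun x => x) X continuousOn_const continuousOn_id,
      cfc_const_one ℝ X hsa, cfc_id' ℝ X hsa]
  · intro x hx
    obtain ⟨h0, h1⟩ := hspec x hx
    have := sin_arccos_sqrt_sq h0 h1
    simpa [sq] using this

/-- With Y = Uᴴ U', Pythagoras splits U' - U into its part in the range of U, of squared norm ‖1 -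
Y‖², and the orthogonal part, of squared norm r - ‖Y‖² = ‖sin Θ‖². -/
theorem sqNorm_sinTheta_le {n r : ℕ} {U U' : Matrix (Fin n) (Fin r) ℂ}
    (hU : Uᴴ * U = 1) (hU' : U'ᴴ * U' = 1) :
    sqNorm (sinTheta U U') ≤ sqNorm (U' - U) := by
  set Y := Uᴴ * U' with hY
  have h1 : ((sqNorm (sinTheta U U') : ℝ) : ℂ) = r - (sqNorm Y : ℝ) := by
    rw [ofReal_sqNorm, sinTheta_conjTranspose_mul_self hU hU', Matrix.trace_sub, ofReal_sqNorm,
      Matrix.trace_one, Fintype.card_fin]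
    congr 1
    rw [Matrix.trace_mul_comm Yᴴ, hY, Matrix.conjTranspose_mul, Matrix.conjTranspose_conjTranspose,
      Matrix.mul_assoc, Matrix.mul_assoc]
  have h2 : ((sqNorm (U' - U) : ℝ) : ℂ) = r - (sqNorm Y : ℝ) + (sqNorm (1 - Y) : ℝ) := by
    rw [ofReal_sqNorm, ofReal_sqNorm, ofReal_sqNorm]
    have hY' : Yᴴ = U'ᴴ * U := by simp [hY]
    simp only [Matrix.conjTranspose_sub, Matrix.sub_mul, Matrix.mul_sub, hU, hU', ← hY, ← hY',
      Matrix.trace_sub, Matrix.conjTranspose_one, Matrix.one_mul, Matrix.mul_one,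
      Matrix.trace_one, Fintype.card_fin]
    ring
  have h3 : sqNorm (U' - U) = sqNorm (sinTheta U U') + sqNorm (1 - Y) := by
    apply Complex.ofReal_injective
    rw [h2, Complex.ofReal_add, h1]
  rw [h3]
  linarith [sqNorm_nonneg (1 - Y)]

/-! ### Growth estimate on the unit interval. -/

/-- If `‖G'‖ ≤ c ‖G‖` and `‖H'‖ ≤ ‖G‖` on `[0, 1]` then `(1 - c) ‖H 1 - H 0‖ ≤ ‖G 0‖`. -/
theorem one_sub_mul_norm_sub_le {E F : Type*} [NormedAddCommGroup E] [NormedSpace ℝ E]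
    [NormedAddCommGroup F] [NormedSpace ℝ F] {G G' : ℝ → E} {H H' : ℝ → F} {c : ℝ} (hc : 0 ≤ c)
    (hc1 : c ≤ 1)
    (hG : ∀ t, HasDerivAt G (G' t) t) (hH : ∀ t, HasDerivAt H (H' t) t)
    (hG' : ∀ t ∈ Set.Icc (0 : ℝ) 1, ‖G' t‖ ≤ c * ‖G t‖)
    (hH' : ∀ t ∈ Set.Icc (0 : ℝ) 1, ‖H' t‖ ≤ ‖G t‖) :
    (1 - c) * ‖H 1 - H 0‖ ≤ ‖G 0‖ := by
  have hcont : Continuous fun t => ‖G t‖ :=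
    (continuous_iff_continuousAt.2 fun t => (hG t).continuousAt).norm
  -- At a maximum point s of ‖G‖, the mean value inequality gives ‖G s‖ ≤ ‖G 0‖ + c ‖G s‖. The same
  -- maximum bounds the increment of H.
  obtain ⟨s, hs, hmax⟩ := isCompact_Icc.exists_isMaxOn (Set.nonempty_Icc.2 (zero_le_one (α := ℝ)))
    hcont.continuousOn
  have hmax' : ∀ t ∈ Set.Icc (0 : ℝ) 1, ‖G t‖ ≤ ‖G s‖ := fun t ht => hmax ht
  have h1 : ‖H 1 - H 0‖ ≤ ‖G s‖ :=
    norm_image_sub_le_of_norm_deriv_le_segment_01' (f' := H')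
      (fun t _ => (hH t).hasDerivWithinAt)
      fun t ht => (hH' t ⟨ht.1, ht.2.le⟩).trans (hmax' t ⟨ht.1, ht.2.le⟩)
  have h2 : ‖G s - G 0‖ ≤ c * ‖G s‖ * (s - 0) :=
    norm_image_sub_le_of_norm_deriv_le_segment' (f' := G') (C := c * ‖G s‖) (b := 1)
      (fun t _ => (hG t).hasDerivWithinAt)
      (fun t ht => (hG' t ⟨ht.1, ht.2.le⟩).trans
        (mul_le_mul_of_nonneg_left (hmax' t ⟨ht.1, ht.2.le⟩) hc)) s hs
  have h3 : c * ‖G s‖ * (s - 0) ≤ c * ‖G s‖ := by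
    rw [sub_zero]
    exact mul_le_of_le_one_right (by positivity) hs.2
  have h4 : ‖G s‖ ≤ ‖G s - G 0‖ + ‖G 0‖ := by simpa using norm_add_le (G s - G 0) (G 0)
  calc (1 - c) * ‖H 1 - H 0‖ ≤ (1 - c) * ‖G s‖ :=
        mul_le_mul_of_nonneg_left h1 (by linarith)
    _ ≤ ‖G 0‖ := by linarith

/-! ### Entrywise differentiation and the Euclidean space of entries. -/

theorem hasDerivAt_matrix_mul {α β γ : Type*} [Fintype β] {F : ℝ → Matrix α β ℂ}
    {G : ℝ → Matrix β γ ℂ} {F' : Matrix α β ℂ} {G' : Matrix β γ ℂ} {t : ℝ}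
    (hF : ∀ a b, HasDerivAt (fun s => F s a b) (F' a b) t)
    (hG : ∀ a b, HasDerivAt (fun s => G s a b) (G' a b) t) (a : α) (b : γ) :
    HasDerivAt (fun s => (F s * G s) a b) ((F' * G t + F t * G') a b) t := by
  simp only [Matrix.mul_apply, Matrix.add_apply, ← Finset.sum_add_distrib]
  exact HasDerivAt.fun_sum fun j _ => (hF a j).mul (hG j b)

theorem hasDerivAt_matrix_const_mul {α β γ : Type*} [Fintype β] (A : Matrix α β ℂ)
    {G : ℝ → Matrix β γ ℂ} {G' : Matrix β γ ℂ} {t : ℝ}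
    (hG : ∀ a b, HasDerivAt (fun s => G s a b) (G' a b) t) (a : α) (b : γ) :
    HasDerivAt (fun s => (A * G s) a b) ((A * G') a b) t := by
  simp only [Matrix.mul_apply]
  exact HasDerivAt.fun_sum fun j _ => (hG j b).const_mul _

theorem hasDerivAt_matrix_conjTranspose {α β : Type*} {F : ℝ → Matrix α β ℂ}
    {F' : Matrix α β ℂ} {t : ℝ} (hF : ∀ a b, HasDerivAt (fun s => F s a b) (F' a b) t)
    (a : β) (b : α) : HasDerivAt (fun s => (F s)ᴴ a b) (F'ᴴ a b) t :=
  (hF b a).star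

theorem CombinedBounds.IsAnalytic.hasDerivAt {m n : ℕ} {F : ℝ → Matrix (Fin m) (Fin n) ℂ}
    (hF : IsAnalytic F) (t : ℝ) (a : Fin m) (b : Fin n) :
    HasDerivAt (fun s => F s a b) (mderiv F t a b) t :=
  (hF a b t (Set.mem_univ t)).differentiableAt.hasDerivAt

theorem hasDerivAt_matrix_fromRows {α β γ : Type*} {F : ℝ → Matrix α γ ℂ} {G : ℝ → Matrix β γ ℂ}
    {F' : Matrix α γ ℂ} {G' : Matrix β γ ℂ} {t : ℝ}
    (hF : ∀ a b, HasDerivAt (fun s => F s a b) (F' a b) t)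
    (hG : ∀ a b, HasDerivAt (fun s => G s a b) (G' a b) t) (a : α ⊕ β) (b : γ) :
    HasDerivAt (fun s => Matrix.fromRows (F s) (G s) a b) (Matrix.fromRows F' G' a b) t := by
  rcases a with a | a
  · exact hF a b
  · exact hG a b

theorem hasDerivAt_matrix_const_smul {α β : Type*} (c : ℂ) {F : ℝ → Matrix α β ℂ}
    {F' : Matrix α β ℂ} {t : ℝ} (hF : ∀ a b, HasDerivAt (fun s => F s a b) (F' a b) t)
    (a : α) (b : β) : HasDerivAt (fun s => (c • F s) a b) ((c • F') a b) t :=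
  (hF a b).const_mul c

theorem sqNorm_smul {α β : Type*} [Fintype α] [Fintype β] (c : ℝ) (M : Matrix α β ℂ) :
    sqNorm ((c : ℂ) • M) = c ^ 2 * sqNorm M := by
  simp only [sqNorm, Finset.mul_sum, Matrix.smul_apply, smul_eq_mul, norm_mul, mul_pow,
    Complex.norm_real, Real.norm_eq_abs, sq_abs]

/-- The entries of a matrix, as a vector of a Euclidean space. -/
noncomputable def entryVec {α β : Type*} (M : Matrix α β ℂ) : EuclideanSpace ℂ (α × β) :=
  WithLp.toLp 2 fun x => M x.1 x.2

theorem norm_entryVec {α β : Type*} [Fintype α] [Fintype β] (M : Matrix α β ℂ) :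
    ‖entryVec M‖ = Real.sqrt (sqNorm M) := by
  rw [EuclideanSpace.norm_eq]
  simp only [entryVec, sqNorm, Fintype.sum_prod_type]

theorem hasDerivAt_entryVec {α β : Type*} [Fintype α] [Fintype β] {M : ℝ → Matrix α β ℂ}
    {M' : Matrix α β ℂ} {t : ℝ} (h : ∀ a b, HasDerivAt (fun s => M s a b) (M' a b) t) :
    HasDerivAt (fun s => entryVec (M s)) (entryVec M') t := by
  have h1 : HasDerivAt (fun s => fun x : α × β => M s x.1 x.2) (fun x => M' x.1 x.2) t :=
    hasDerivAt_pi.2 fun x => h _ _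
  exact ((PiLp.continuousLinearEquiv 2 ℝ
    (fun _ : α × β => ℂ)).symm.toContinuousLinearMap.hasFDerivAt.comp_hasDerivAt t h1)

theorem entryVec_sub {α β : Type*} (M N : Matrix α β ℂ) :
    entryVec M - entryVec N = entryVec (M - N) := rfl

/-! ### Block algebra of the decomposition. -/

theorem blockRow_mul_conjTranspose {m n k : ℕ} {r : Fin k → ℕ}
    (X : (j : Fin k) → Matrix (Fin m) (Fin (r j)) ℂ)
    (Y : (j : Fin k) → Matrix (Fin n) (Fin (r j)) ℂ) :
    blockRow X * (blockRow Y)ᴴ = ∑ j, X j * (Y j)ᴴ := by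
  ext a b
  simp [blockRow, Matrix.mul_apply, Fintype.sum_sigma, Matrix.sum_apply]

theorem blockRow_mul_blockDiagonal {m k : ℕ} {r : Fin k → ℕ}
    (X : (j : Fin k) → Matrix (Fin m) (Fin (r j)) ℂ)
    (S : (j : Fin k) → Matrix (Fin (r j)) (Fin (r j)) ℂ) :
    blockRow X * Matrix.blockDiagonal' S = blockRow fun j => X j * S j := by
  ext a ⟨j, b⟩
  simp only [blockRow, Matrix.mul_apply, Fintype.sum_sigma, Matrix.of_apply]
  rw [Finset.sum_eq_single j]
  · simp
  · intro i _ hi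
    simp [Matrix.blockDiagonal'_apply_ne _ _ _ hi]
  · simp

theorem sqNorm_blockRow_conjTranspose_mul {m p k : ℕ} {r : Fin k → ℕ}
    (X : (j : Fin k) → Matrix (Fin m) (Fin (r j)) ℂ) (M : Matrix (Fin m) (Fin p) ℂ) :
    sqNorm ((blockRow X)ᴴ * M) = ∑ j, sqNorm ((X j)ᴴ * M) := by
  simp only [sqNorm, Fintype.sum_sigma]
  rfl

namespace CombinedBounds.IsAnalyticBlockSVD

variable {m n k : ℕ} {r : Fin k → ℕ} {B : ℝ → Matrix (Fin m) (Fin n) ℂ}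
    {W : (j : Fin k) → ℝ → Matrix (Fin m) (Fin (r j)) ℂ}
    {Wl : ℝ → Matrix (Fin m) (Fin (m - n)) ℂ}
    {V : (j : Fin k) → ℝ → Matrix (Fin n) (Fin (r j)) ℂ}
    {S : (j : Fin k) → ℝ → Matrix (Fin (r j)) (Fin (r j)) ℂ}

theorem W_mul_self (h : IsAnalyticBlockSVD r B W Wl V S) (t : ℝ) (j : Fin k) :
    (W j t)ᴴ * W j t = 1 := by
  ext a b
  have := congrFun (congrFun (h.unitary_W t).1 (Sum.inl ⟨j, a⟩)) (Sum.inl ⟨j, b⟩)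
  simpa [Matrix.mul_apply, blockRow, Matrix.one_apply] using this

theorem W_mul_of_ne (h : IsAnalyticBlockSVD r B W Wl V S) (t : ℝ) {i j : Fin k} (hij : i ≠ j) :
    (W i t)ᴴ * W j t = 0 := by
  ext a b
  have := congrFun (congrFun (h.unitary_W t).1 (Sum.inl ⟨i, a⟩)) (Sum.inl ⟨j, b⟩)
  simpa [Matrix.mul_apply, blockRow, Matrix.one_apply, hij] using this

theorem Wl_mul (h : IsAnalyticBlockSVD r B W Wl V S) (t : ℝ) (j : Fin k) :
    (Wl t)ᴴ * W j t = 0 := by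
  ext a b
  have := congrFun (congrFun (h.unitary_W t).1 (Sum.inr a)) (Sum.inl ⟨j, b⟩)
  simpa [Matrix.mul_apply, blockRow, Matrix.one_apply] using this

theorem V_mul_self (h : IsAnalyticBlockSVD r B W Wl V S) (t : ℝ) (j : Fin k) :
    (V j t)ᴴ * V j t = 1 := by
  ext a b
  have := congrFun (congrFun (h.unitary_V t).1 ⟨j, a⟩) ⟨j, b⟩
  simpa [Matrix.mul_apply, blockRow, Matrix.one_apply] using this

theorem V_mul_of_ne (h : IsAnalyticBlockSVD r B W Wl V S) (t : ℝ) {i j : Fin k} (hij : i ≠ j) :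
    (V i t)ᴴ * V j t = 0 := by
  ext a b
  have := congrFun (congrFun (h.unitary_V t).1 ⟨i, a⟩) ⟨j, b⟩
  simpa [Matrix.mul_apply, blockRow, Matrix.one_apply, hij] using this

theorem eq_sum (h : IsAnalyticBlockSVD r B W Wl V S) (t : ℝ) :
    B t = ∑ j, W j t * S j t * (V j t)ᴴ := by
  rw [h.decomp t, tallBlockDiag, Matrix.fromCols_mul_fromRows, Matrix.mul_zero, add_zero,
    blockRow_mul_blockDiagonal, blockRow_mul_conjTranspose]

theorem W_conjTranspose_mul (h : IsAnalyticBlockSVD r B W Wl V S) (t : ℝ) (j : Fin k) :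
    (W j t)ᴴ * B t = S j t * (V j t)ᴴ := by
  rw [h.eq_sum t, Matrix.mul_sum, Finset.sum_eq_single j]
  · rw [← Matrix.mul_assoc, ← Matrix.mul_assoc, h.W_mul_self, Matrix.one_mul]
  · intro i _ hi
    rw [← Matrix.mul_assoc, ← Matrix.mul_assoc, h.W_mul_of_ne t hi.symm, Matrix.zero_mul,
      Matrix.zero_mul]
  · simp

theorem Wl_conjTranspose_mul (h : IsAnalyticBlockSVD r B W Wl V S) (t : ℝ) :
    (Wl t)ᴴ * B t = 0 := by
  rw [h.eq_sum t, Matrix.mul_sum]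
  refine Finset.sum_eq_zero fun i _ => ?_
  rw [← Matrix.mul_assoc, ← Matrix.mul_assoc, h.Wl_mul, Matrix.zero_mul, Matrix.zero_mul]

theorem mul_V (h : IsAnalyticBlockSVD r B W Wl V S) (t : ℝ) (j : Fin k) :
    B t * V j t = W j t * S j t := by
  rw [h.eq_sum t, Matrix.sum_mul, Finset.sum_eq_single j]
  · rw [Matrix.mul_assoc, h.V_mul_self, Matrix.mul_one]
  · intro i _ hi
    rw [Matrix.mul_assoc, h.V_mul_of_ne t hi, Matrix.mul_zero]
  · simp

theorem conjTranspose_mul_W (h : IsAnalyticBlockSVD r B W Wl V S) (t : ℝ) (j : Fin k) :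
    (B t)ᴴ * W j t = V j t * (S j t)ᴴ := by
  simpa using congrArg Matrix.conjTranspose (h.W_conjTranspose_mul t j)

theorem V_conjTranspose_mul (h : IsAnalyticBlockSVD r B W Wl V S) (t : ℝ) (j : Fin k) :
    (V j t)ᴴ * (B t)ᴴ = (S j t)ᴴ * (W j t)ᴴ := by
  simpa using congrArg Matrix.conjTranspose (h.mul_V t j)

theorem sqNorm_eq_sum_W (h : IsAnalyticBlockSVD r B W Wl V S) (t : ℝ) {p : ℕ}
    (M : Matrix (Fin m) (Fin p) ℂ) :
    sqNorm M = ∑ j, sqNorm ((W j t)ᴴ * M) + sqNorm ((Wl t)ᴴ * M) := by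
  rw [← sqNorm_isometry_mul (h.unitary_W t).conjTranspose.1 M,
    Matrix.conjTranspose_fromCols_eq_fromRows_conjTranspose, Matrix.fromRows_mul, sqNorm_fromRows,
    sqNorm_blockRow_conjTranspose_mul]

theorem sqNorm_eq_sum_V (h : IsAnalyticBlockSVD r B W Wl V S) (t : ℝ) {p : ℕ}
    (M : Matrix (Fin n) (Fin p) ℂ) :
    sqNorm M = ∑ j, sqNorm ((V j t)ᴴ * M) := by
  rw [← sqNorm_isometry_mul (h.unitary_V t).conjTranspose.1 M, sqNorm_blockRow_conjTranspose_mul]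

end CombinedBounds.IsAnalyticBlockSVD

/-! ### Derivative estimates and the combined bound along the pencil. -/

section Pencil

variable {m n k : ℕ} {r : Fin k → ℕ} {B ΔB : Matrix (Fin m) (Fin n) ℂ}
    {W : (j : Fin k) → ℝ → Matrix (Fin m) (Fin (r j)) ℂ}
    {Wl : ℝ → Matrix (Fin m) (Fin (m - n)) ℂ}
    {V : (j : Fin k) → ℝ → Matrix (Fin n) (Fin (r j)) ℂ}
    {S : (j : Fin k) → ℝ → Matrix (Fin (r j)) (Fin (r j)) ℂ}

theorem hasDerivAt_pencil (B ΔB : Matrix (Fin m) (Fin n) ℂ) (t : ℝ) (a : Fin m) (b : Fin n) :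
    HasDerivAt (fun s : ℝ => (B + (s : ℂ) • ΔB) a b) (ΔB a b) t := by
  simp only [Matrix.add_apply, Matrix.smul_apply, smul_eq_mul]
  have h : HasDerivAt (fun s : ℝ => (s : ℂ)) 1 t := Complex.ofRealCLM.hasDerivAt
  simpa using (h.mul_const (ΔB a b)).const_add (B a b)

theorem deriv_mul_V (h : IsAnalyticBlockSVD r (fun t => B + (t : ℂ) • ΔB) W Wl V S) (t : ℝ)
    (j : Fin k) :
    ΔB * V j t + (B + (t : ℂ) • ΔB) * mderiv (V j) t =
      mderiv (W j) t * S j t + W j t * mderiv (S j) t := by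
  ext a b
  have h1 := hasDerivAt_matrix_mul (hasDerivAt_pencil B ΔB t) ((h.analytic_V j).hasDerivAt t) a b
  have h2 := hasDerivAt_matrix_mul ((h.analytic_W j).hasDerivAt t)
    ((h.analytic_S j).hasDerivAt t) a b
  have h3 : (fun s : ℝ => ((B + (s : ℂ) • ΔB) * V j s) a b) = fun s => (W j s * S j s) a b := by
    ext s; rw [← h.mul_V s j]
  rw [h3] at h1
  exact h1.unique h2

theorem deriv_conjTranspose_mul_W
    (h : IsAnalyticBlockSVD r (fun t => B + (t : ℂ) • ΔB) W Wl V S) (t : ℝ) (j : Fin k) :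
    ΔBᴴ * W j t + (B + (t : ℂ) • ΔB)ᴴ * mderiv (W j) t =
      mderiv (V j) t * (S j t)ᴴ + V j t * (mderiv (S j) t)ᴴ := by
  ext a b
  have h1 := hasDerivAt_matrix_mul (hasDerivAt_matrix_conjTranspose (hasDerivAt_pencil B ΔB t))
    ((h.analytic_W j).hasDerivAt t) a b
  have h2 := hasDerivAt_matrix_mul ((h.analytic_V j).hasDerivAt t)
    (hasDerivAt_matrix_conjTranspose ((h.analytic_S j).hasDerivAt t)) a b
  have h3 : (fun s : ℝ => ((B + (s : ℂ) • ΔB)ᴴ * W j s) a b) =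
      fun s => (V j s * (S j s)ᴴ) a b := by
    ext s; rw [← h.conjTranspose_mul_W s j]
  rw [h3] at h1
  exact h1.unique h2

/-- The pointwise estimate of the derivatives of the blocks by the perturbation. -/
theorem sqNorm_mderiv_le (h : IsAnalyticBlockSVD r (fun t => B + (t : ℂ) • ΔB) W Wl V S)
    (hnorm : IsNormalized W Wl V) (j : Fin k) (t : ℝ) {a b : ℝ} (ha : 0 ≤ a) (hab : a ≤ b)
    (hb : ∀ i, i ≠ j → ∀ p q, b ≤ |singVal (S j t) p - singVal (S i t) q|)
    (hmin : m = n ∨ ∀ p, a ≤ singVal (S j t) p) :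
    2 * sqNorm (mderiv (S j) t) + a ^ 2 * sqNorm (mderiv (W j) t) +
        b ^ 2 * sqNorm (mderiv (V j) t) ≤
      sqNorm (ΔB * V j t) + sqNorm (ΔBᴴ * W j t) := by
  have hW := hnorm.W_eq j t
  have hV := hnorm.V_eq j t
  have e1 := deriv_mul_V h t j
  have e2 := deriv_conjTranspose_mul_W h t j
  have hWB := h.W_conjTranspose_mul t
  have hVB := h.V_conjTranspose_mul t
  have hWlB := h.Wl_conjTranspose_mul t
  generalize B + (t : ℂ) • ΔB = C at e1 e2 hWB hVB hWlB
  -- Since W_iᴴ B = S_i V_iᴴ, testing the differentiated relation with W_i closes it in the unknowns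
  -- W_iᴴ Ẇ_j and V_iᴴ V̇_j.
  have f1 : ∀ i, (W i t)ᴴ * (ΔB * V j t) = ((W i t)ᴴ * mderiv (W j) t) * S j t -
      S i t * ((V i t)ᴴ * mderiv (V j) t) + (W i t)ᴴ * W j t * mderiv (S j) t := by
    intro i
    have := congrArg ((W i t)ᴴ * ·) e1
    simp only [Matrix.mul_add (W i t)ᴴ, ← Matrix.mul_assoc] at this
    rw [hWB i] at this
    simp only [← Matrix.mul_assoc]
    rw [eq_sub_of_add_eq this]
    abel
  have f2 : ∀ i, (V i t)ᴴ * (ΔBᴴ * W j t) = ((V i t)ᴴ * mderiv (V j) t) * (S j t)ᴴ -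
      (S i t)ᴴ * ((W i t)ᴴ * mderiv (W j) t) + (V i t)ᴴ * V j t * (mderiv (S j) t)ᴴ := by
    intro i
    have := congrArg ((V i t)ᴴ * ·) e2
    simp only [Matrix.mul_add (V i t)ᴴ, ← Matrix.mul_assoc] at this
    rw [hVB i] at this
    simp only [← Matrix.mul_assoc]
    rw [eq_sub_of_add_eq this]
    abel
  have f3 : (Wl t)ᴴ * (ΔB * V j t) = ((Wl t)ᴴ * mderiv (W j) t) * S j t := by
    have := congrArg ((Wl t)ᴴ * ·) e1
    simp only [Matrix.mul_add (Wl t)ᴴ, ← Matrix.mul_assoc] at this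
    rw [hWlB, h.Wl_mul t j] at this
    simpa [← Matrix.mul_assoc] using this
  -- The complementary block W_{k+1} has no partner in V, so only the smallest singular value of S_j
  -- controls it. This is why W carries the weight a and V the weight b; for m = n the block is
  -- empty.
  have g3 : a ^ 2 * sqNorm ((Wl t)ᴴ * mderiv (W j) t) ≤ sqNorm ((Wl t)ᴴ * (ΔB * V j t)) := by
    rw [f3]
    rcases hmin with rfl | hmin
    · have : IsEmpty (Fin (m - m)) := by rw [Nat.sub_self]; infer_instance
      simp [sqNorm]
    · exact le_sqNorm_mul _ _ ha hmin
  have g : ∀ i, (if i = j then 2 * sqNorm (mderiv (S j) t) else 0) +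
      a ^ 2 * sqNorm ((W i t)ᴴ * mderiv (W j) t) + b ^ 2 * sqNorm ((V i t)ᴴ * mderiv (V j) t) ≤
      sqNorm ((W i t)ᴴ * (ΔB * V j t)) + sqNorm ((V i t)ᴴ * (ΔBᴴ * W j t)) := by
    intro i
    rw [f1, f2]
    split_ifs with hij
    -- In the diagonal block the normalization removes both unknowns. Each of the two equations
    -- contributes one copy of ‖Ṡ_j‖², whence the factor 2.
    · subst hij
      simp only [hW, hV, h.W_mul_self, h.V_mul_self, Matrix.zero_mul, Matrix.mul_zero, sub_zero,
        zero_add, Matrix.one_mul, sqNorm_conjTranspose]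
      simp [sqNorm, two_mul]
    · rw [h.W_mul_of_ne t hij, h.V_mul_of_ne t hij]
      simp only [Matrix.zero_mul, add_zero, zero_add]
      -- The off-diagonal blocks satisfy the bound with b on both terms; a ≤ b weakens the one for
      -- W.
      refine le_trans ?_ (le_sqNorm_sylvester _ _ _ _ (ha.trans hab) (hb i hij))
      rw [mul_add]
      gcongr
      exact sqNorm_nonneg _
  have gs := Finset.sum_le_sum fun i (_ : i ∈ Finset.univ) => g i
  simp only [Finset.sum_add_distrib, Finset.sum_ite_eq', Finset.mem_univ, if_true,
    ← Finset.mul_sum] at gs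
  rw [h.sqNorm_eq_sum_W t (mderiv (W j) t), h.sqNorm_eq_sum_V t (mderiv (V j) t),
    h.sqNorm_eq_sum_W t (ΔB * V j t), h.sqNorm_eq_sum_V t (ΔBᴴ * W j t)]
  linarith

/-- The combined bound in terms of lower bounds `a`, `b` for the gaps. -/
theorem combined_bound (h : IsAnalyticBlockSVD r (fun t => B + (t : ℂ) • ΔB) W Wl V S)
    (hnorm : IsNormalized W Wl V) (j : Fin k) {x a b : ℝ}
    (hx : x = Matrix.instL2OpNormedAddCommGroup.toNorm.norm ΔB) (hxa : x < a) (hab : a ≤ b)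
    (hb : ∀ t ∈ Set.Icc (0 : ℝ) 1, ∀ i, i ≠ j →
      ∀ p q, b ≤ |singVal (S j t) p - singVal (S i t) q|)
    (hmin : m = n ∨ ∀ t ∈ Set.Icc (0 : ℝ) 1, ∀ p, a ≤ singVal (S j t) p) :
    (1 - x / a) ^ 2 * (2 * sqNorm (Sing (S j 1) - Sing (S j 0)) +
        a ^ 2 * sqNorm (sinTheta (W j 0) (W j 1)) + b ^ 2 * sqNorm (sinTheta (V j 0) (V j 1))) ≤
      sqNorm (ΔB * V j 0) + sqNorm ((W j 0)ᴴ * ΔB) := by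
  have hx0 : 0 ≤ x := by
    rw [hx]
    let _ := Matrix.instL2OpNormedAddCommGroup (m := Fin m) (n := Fin n) (𝕜 := ℂ)
    exact norm_nonneg ΔB
  have hx' : x = Matrix.instL2OpNormedAddCommGroup.toNorm.norm ΔBᴴ := by
    rw [hx]
    exact (Matrix.l2_opNorm_conjTranspose ΔB).symm
  have ha : 0 < a := hx0.trans_lt hxa
  have hb0 : 0 < b := ha.trans_le hab
  have hc0 : 0 ≤ x / a := by positivity
  have hc1 : x / a ≤ 1 := (div_le_one ha).2 hxa.le
  set c := x / a with hc
  have hca : c * a = x := div_mul_cancel₀ x ha.ne'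
  have hWd := fun t => (h.analytic_W j).hasDerivAt t
  have hVd := fun t => (h.analytic_V j).hasDerivAt t
  have hSd := fun t => (h.analytic_S j).hasDerivAt t
  have key : ∀ t ∈ Set.Icc (0 : ℝ) 1, _ := fun t ht =>
    sqNorm_mderiv_le h hnorm j t ha.le hab (hb t ht) (hmin.imp_right fun h' => h' t ht)
  have main := one_sub_mul_norm_sub_le hc0 hc1
    (G := fun t => entryVec (Matrix.fromRows (ΔB * V j t) (ΔBᴴ * W j t)))
    (H := fun t => entryVec (Matrix.fromRows (((√2 : ℝ) : ℂ) • S j t)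
      (Matrix.fromRows ((a : ℂ) • W j t) ((b : ℂ) • V j t))))
    (fun t => hasDerivAt_entryVec (hasDerivAt_matrix_fromRows
      (hasDerivAt_matrix_const_mul ΔB (hVd t)) (hasDerivAt_matrix_const_mul ΔBᴴ (hWd t))))
    (fun t => hasDerivAt_entryVec (hasDerivAt_matrix_fromRows
      (hasDerivAt_matrix_const_smul _ (hSd t)) (hasDerivAt_matrix_fromRows
        (hasDerivAt_matrix_const_smul _ (hWd t)) (hasDerivAt_matrix_const_smul _ (hVd t)))))
    ?_ ?_
  · rw [entryVec_sub, norm_entryVec, norm_entryVec] at main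
    have main2 := pow_le_pow_left₀ (mul_nonneg (by linarith) (Real.sqrt_nonneg _)) main 2
    rw [mul_pow, Real.sq_sqrt (sqNorm_nonneg _), Real.sq_sqrt (sqNorm_nonneg _)] at main2
    have hsub : Matrix.fromRows (((√2 : ℝ) : ℂ) • S j 1)
        (Matrix.fromRows ((a : ℂ) • W j 1) ((b : ℂ) • V j 1)) -
        Matrix.fromRows (((√2 : ℝ) : ℂ) • S j 0)
        (Matrix.fromRows ((a : ℂ) • W j 0) ((b : ℂ) • V j 0)) =
        Matrix.fromRows (((√2 : ℝ) : ℂ) • (S j 1 - S j 0))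
        (Matrix.fromRows ((a : ℂ) • (W j 1 - W j 0)) ((b : ℂ) • (V j 1 - V j 0))) := by
      ext (p | p | p) q <;> simp [mul_sub]
    rw [hsub] at main2
    simp only [sqNorm_fromRows, sqNorm_smul, Real.sq_sqrt zero_le_two] at main2
    have hconj : sqNorm ((W j 0)ᴴ * ΔB) = sqNorm (ΔBᴴ * W j 0) := by
      rw [← sqNorm_conjTranspose]
      simp
    rw [hconj]
    refine le_trans (mul_le_mul_of_nonneg_left ?_ (sq_nonneg _)) main2
    have s1 := sqNorm_Sing_sub_le (S j 1) (S j 0)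
    have s2 := sqNorm_sinTheta_le (h.W_mul_self 0 j) (h.W_mul_self 1 j)
    have s3 := sqNorm_sinTheta_le (h.V_mul_self 0 j) (h.V_mul_self 1 j)
    rw [← add_assoc]
    gcongr
  · intro t ht
    rw [norm_entryVec, norm_entryVec]
    refine Real.sqrt_le_iff.2 ⟨by positivity, ?_⟩
    rw [mul_pow, Real.sq_sqrt (sqNorm_nonneg _), sqNorm_fromRows, sqNorm_fromRows]
    refine le_trans ?_ (mul_le_mul_of_nonneg_left (key t ht) (sq_nonneg c))
    have k1 := sqNorm_mul_le ΔB (mderiv (V j) t)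
    have k2 := sqNorm_mul_le ΔBᴴ (mderiv (W j) t)
    rw [← hx] at k1
    rw [← hx'] at k2
    have n1 := sqNorm_nonneg (mderiv (S j) t)
    have n3 := sqNorm_nonneg (mderiv (V j) t)
    -- x = c a ≤ c b.
    have k3 : x ^ 2 * sqNorm (mderiv (V j) t) ≤ c ^ 2 * (b ^ 2 * sqNorm (mderiv (V j) t)) := by
      rw [← hca, mul_pow, mul_assoc]
      gcongr
    have k4 : x ^ 2 * sqNorm (mderiv (W j) t) = c ^ 2 * (a ^ 2 * sqNorm (mderiv (W j) t)) := by
      rw [← hca, mul_pow, mul_assoc]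
    have k5 : 0 ≤ c ^ 2 * (2 * sqNorm (mderiv (S j) t)) := by positivity
    linarith
  · intro t ht
    rw [norm_entryVec, norm_entryVec]
    refine Real.sqrt_le_sqrt ?_
    simp only [sqNorm_fromRows, sqNorm_smul, Real.sq_sqrt zero_le_two]
    linarith [key t ht]

end Pencil

/-! ### Transfer to extended nonnegative reals, including infinite gaps. -/

theorem le_of_ofReal_le_gapMin {k : ℕ} {r : Fin k → ℕ}
    {S : (j : Fin k) → ℝ → Matrix (Fin (r j)) (Fin (r j)) ℂ} {j : Fin k} {b : ℝ}
    (h : ENNReal.ofReal b ≤ gapMin S j) {t : ℝ} (ht : t ∈ Set.Icc (0 : ℝ) 1) {i : Fin k}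
    (hi : i ≠ j) (p : Fin (r j)) (q : Fin (r i)) :
    b ≤ |singVal (S j t) p - singVal (S i t) q| := by
  have h1 : gapMin S j ≤ gap (fun i => S i t) j := iInf₂_le t ht
  have h2 : gap (fun i => S i t) j ≤ singDist (S j t) (S i t) :=
    iInf₂_le (f := fun i (_ : i ≠ j) => singDist (S j t) (S i t)) i hi
  have h3 : singDist (S j t) (S i t) ≤ ENNReal.ofReal |singVal (S j t) p - singVal (S i t) q| :=
    iInf₂_le (f := fun a b => ENNReal.ofReal |singVal (S j t) a - singVal (S i t) b|) p q
  exact (ENNReal.ofReal_le_ofReal_iff (abs_nonneg _)).1 (h.trans (h1.trans (h2.trans h3)))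

theorem le_of_ofReal_le_gapHatMin {k : ℕ} {r : Fin k → ℕ}
    {S : (j : Fin k) → ℝ → Matrix (Fin (r j)) (Fin (r j)) ℂ} {j : Fin k} {a : ℝ}
    (h : ENNReal.ofReal a ≤ gapHatMin S j) {t : ℝ} (ht : t ∈ Set.Icc (0 : ℝ) 1)
    (p : Fin (r j)) : a ≤ singVal (S j t) p := by
  refine (ENNReal.ofReal_le_ofReal_iff (singVal_nonneg _ _)).1 (h.trans ?_)
  exact (iInf₂_le t ht).trans ((min_le_right _ _).trans (iInf_le _ p))

theorem gapHatMin_le_gapMin {k : ℕ} {r : Fin k → ℕ}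
    (S : (j : Fin k) → ℝ → Matrix (Fin (r j)) (Fin (r j)) ℂ) (j : Fin k) :
    gapHatMin S j ≤ gapMin S j :=
  iInf₂_mono fun _ _ => min_le_left _ _

theorem gapHatMin_ne_top {k : ℕ} {r : Fin k → ℕ}
    (S : (j : Fin k) → ℝ → Matrix (Fin (r j)) (Fin (r j)) ℂ) {j : Fin k} (hj : 0 < r j) :
    gapHatMin S j ≠ ∞ := by
  refine ne_top_of_le_ne_top (ENNReal.ofReal_ne_top (r := singVal (S j 0) ⟨0, hj⟩)) ?_
  exact (iInf₂_le 0 ⟨le_rfl, zero_le_one⟩).trans ((min_le_right _ _).trans (iInf_le _ _))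

/-- A nonnegative number whose multiples by arbitrarily large squares are bounded vanishes. -/
theorem eq_zero_of_sq_mul_le {v C N : ℝ} (hv : 0 ≤ v) (h : ∀ b, N ≤ b → b ^ 2 * v ≤ C) : v = 0 := by
  by_contra hne
  have hpos : 0 < v := lt_of_le_of_ne hv (Ne.symm hne)
  -- The value is large enough that b v > C, and at least 1 so that b² v ≥ b v.
  set b := max N (C / v + 1) ⊔ 1 with hb
  have h1 : 1 ≤ b := le_max_right _ _
  have h2 : C / v + 1 ≤ b := (le_max_right _ _).trans (le_max_left _ _)
  have h3 := h b ((le_max_left _ _).trans (le_max_left _ _))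
  have h4 : C < b * v := by
    rw [← div_lt_iff₀ hpos]; linarith
  have h5 : b * v ≤ b ^ 2 * v := mul_le_mul_of_nonneg_right (by nlinarith) hv
  linarith

theorem mainTheorem6 {m n k : ℕ} [NeZero k] (hmn : n ≤ m)
    (r : Fin k → ℕ) (hr : ∀ j, 0 < r j) (hsum : ∑ j, r j = n)
    (B ΔB : Matrix (Fin m) (Fin n) ℂ)
    (W : (j : Fin k) → ℝ → Matrix (Fin m) (Fin (r j)) ℂ)
    (Wl : ℝ → Matrix (Fin m) (Fin (m - n)) ℂ)
    (V : (j : Fin k) → ℝ → Matrix (Fin n) (Fin (r j)) ℂ)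
    (S : (j : Fin k) → ℝ → Matrix (Fin (r j)) (Fin (r j)) ℂ)
    (hdec : IsAnalyticBlockSVD r (fun t => B + (t : ℂ) • ΔB) W Wl V S)
    (hnorm : IsNormalized W Wl V) :
    (specNorm ΔB < gapHatMin S 0 →
      2 * frobNorm (Sing (S 0 1) - Sing (S 0 0)) ^ 2
          + gapHatMin S 0 ^ 2 * frobNorm (sinTheta (W 0 0) (W 0 1)) ^ 2
          + gapMin S 0 ^ 2 * frobNorm (sinTheta (V 0 0) (V 0 1)) ^ 2
        ≤ (gapHatMin S 0 / (gapHatMin S 0 - specNorm ΔB)) ^ 2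
            * (frobNorm (ΔB * V 0 0) ^ 2 + frobNorm ((W 0 0)ᴴ * ΔB) ^ 2)) ∧
    (m = n → specNorm ΔB < gapMin S 0 →
      2 * (1 - specNorm ΔB / gapMin S 0) ^ 2
            * frobNorm (Sing (S 0 1) - Sing (S 0 0)) ^ 2
          + (gapMin S 0 - specNorm ΔB) ^ 2
            * (frobNorm (sinTheta (W 0 0) (W 0 1)) ^ 2
              + frobNorm (sinTheta (V 0 0) (V 0 1)) ^ 2)
        ≤ frobNorm (ΔB * V 0 0) ^ 2 + frobNorm ((W 0 0)ᴴ * ΔB) ^ 2) := by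
  have bound := fun a b : ℝ => combined_bound hdec hnorm 0 (a := a) (b := b) rfl
  have hx0 : 0 ≤ Matrix.instL2OpNormedAddCommGroup.toNorm.norm ΔB := by
    let _ := Matrix.instL2OpNormedAddCommGroup (m := Fin m) (n := Fin n) (𝕜 := ℂ)
    exact norm_nonneg ΔB
  simp only [frobNorm_sq, specNorm]
  generalize Matrix.instL2OpNormedAddCommGroup.toNorm.norm ΔB = x at bound hx0
  have hs0 := sqNorm_nonneg (Sing (S 0 1) - Sing (S 0 0))
  have hw0 := sqNorm_nonneg (sinTheta (W 0 0) (W 0 1))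
  have hv0 := sqNorm_nonneg (sinTheta (V 0 0) (V 0 1))
  have hR0 := sqNorm_nonneg (ΔB * V 0 0)
  have hR0' := sqNorm_nonneg ((W 0 0)ᴴ * ΔB)
  generalize sqNorm (Sing (S 0 1) - Sing (S 0 0)) = s at bound hs0
  generalize sqNorm (sinTheta (W 0 0) (W 0 1)) = w at bound hw0
  generalize sqNorm (sinTheta (V 0 0) (V 0 1)) = v at bound hv0
  generalize sqNorm (ΔB * V 0 0) = R at bound hR0
  generalize sqNorm ((W 0 0)ᴴ * ΔB) = R' at bound hR0'
  have two_eq : (2 : ℝ≥0∞) = ENNReal.ofReal 2 := by simp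
  constructor
  · intro hlt
    obtain ⟨a, ha0, ha⟩ : ∃ a : ℝ, 0 ≤ a ∧ gapHatMin S 0 = ENNReal.ofReal a :=
      ⟨_, ENNReal.toReal_nonneg, (ENNReal.ofReal_toReal (gapHatMin_ne_top S (hr 0))).symm⟩
    have hle := gapHatMin_le_gapMin S 0
    have hxa : x < a := by
      rw [ha] at hlt
      exact (ENNReal.ofReal_lt_ofReal_iff_of_nonneg hx0).1 hlt
    have hapos : 0 < a := hx0.trans_lt hxa
    have hsub : 0 < a - x := sub_pos.2 hxa
    have hmin : m = n ∨ ∀ t ∈ Set.Icc (0 : ℝ) 1, ∀ p, a ≤ singVal (S 0 t) p :=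
      Or.inr fun t ht p => le_of_ofReal_le_gapHatMin ha.ge ht p
    -- Keeping b free, rather than equal to the gap, covers the infinite gap as well.
    have bound' : ∀ b, a ≤ b → ENNReal.ofReal b ≤ gapMin S 0 →
        2 * s + a ^ 2 * w + b ^ 2 * v ≤ (a / (a - x)) ^ 2 * (R + R') := by
      intro b hab hb
      have h1 := bound a b hxa hab (fun t ht i hi p q => le_of_ofReal_le_gapMin hb ht hi p q) hmin
      have h2 : 1 - x / a = (a / (a - x))⁻¹ := by field_simp
      rw [h2, inv_pow, inv_mul_le_iff₀ (by positivity)] at h1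
      exact h1
    rw [ha, ← ENNReal.ofReal_sub _ hx0, ← ENNReal.ofReal_div_of_pos hsub, two_eq,
      ← ENNReal.ofReal_pow (by positivity), ← ENNReal.ofReal_pow (by positivity),
      ← ENNReal.ofReal_mul zero_le_two, ← ENNReal.ofReal_mul (by positivity),
      ← ENNReal.ofReal_add hR0 hR0', ← ENNReal.ofReal_mul (by positivity),
      ← ENNReal.ofReal_add (by positivity) (by positivity)]
    by_cases htop : gapMin S 0 = ∞
    -- With an infinite gap b is arbitrarily large, which forces v = 0. The convention ∞ · 0 = 0
    -- then removes the term, and b = a gives the rest.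
    · have hv : v = 0 := eq_zero_of_sq_mul_le (N := a) (C := (a / (a - x)) ^ 2 * (R + R')) hv0
        fun b hb => by
          have := bound' b hb (by rw [htop]; exact le_top)
          have h1 : 0 ≤ a ^ 2 * w := by positivity
          linarith
      have := bound' a le_rfl (by rw [htop]; exact le_top)
      rw [hv, ENNReal.ofReal_zero, mul_zero, add_zero]
      refine ENNReal.ofReal_le_ofReal ?_
      rwa [hv, mul_zero, add_zero] at this
    · obtain ⟨b, hb0, hb⟩ : ∃ b : ℝ, 0 ≤ b ∧ gapMin S 0 = ENNReal.ofReal b :=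
        ⟨_, ENNReal.toReal_nonneg, (ENNReal.ofReal_toReal htop).symm⟩
      have hab : a ≤ b := by
        rw [ha, hb] at hle
        exact (ENNReal.ofReal_le_ofReal_iff hb0).1 hle
      rw [hb, ← ENNReal.ofReal_pow hb0, ← ENNReal.ofReal_mul (by positivity),
        ← ENNReal.ofReal_add (by positivity) (by positivity)]
      exact ENNReal.ofReal_le_ofReal (bound' b hab hb.ge)
  · intro hmn' hlt
    have bound' : ∀ b, x < b → ENNReal.ofReal b ≤ gapMin S 0 →
        2 * (1 - x / b) ^ 2 * s + (b - x) ^ 2 * (w + v) ≤ R + R' := by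
      intro b hxb hb
      have h1 := bound b b hxb le_rfl
        (fun t ht i hi p q => le_of_ofReal_le_gapMin hb ht hi p q) (Or.inl hmn')
      have hb0 : b ≠ 0 := (hx0.trans_lt hxb).ne'
      have h2 : b - x = (1 - x / b) * b := by field_simp
      rw [h2, mul_pow]
      linarith
    by_cases htop : gapMin S 0 = ∞
    · have hle : ∀ b : ℝ, ENNReal.ofReal b ≤ gapMin S 0 := fun b => by rw [htop]; exact le_top
      have hwv : w + v = 0 := eq_zero_of_sq_mul_le (N := 1) (C := R + R') (by positivity)
        fun b hb => by
          -- The shift by x turns the coefficient (b - x)² into b².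
          have h1 := bound' (b + x) (by linarith) (hle _)
          rw [add_sub_cancel_right] at h1
          have : 0 ≤ 2 * (1 - x / (b + x)) ^ 2 * s := by positivity
          linarith
      have hw : w = 0 := by linarith
      have hv : v = 0 := by linarith
      -- Any fixed b still loses the factor (1 - x/b)². Letting b → ∞ recovers the factor 1 that the
      -- convention x/∞ = 0 requires.
      have hlim : Filter.Tendsto (fun b : ℝ => 2 * (1 - x / b) ^ 2 * s) Filter.atTop
          (nhds (2 * (1 - 0) ^ 2 * s)) :=
        ((((Filter.tendsto_id.const_div_atTop x).const_sub 1).pow 2).const_mul 2).mul_const s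
      have hs : 2 * (1 - 0) ^ 2 * s ≤ R + R' := by
        refine le_of_tendsto hlim ?_
        filter_upwards [Filter.eventually_gt_atTop x] with b hb
        have h1 := bound' b hb (hle b)
        rw [hwv, mul_zero, add_zero] at h1
        exact h1
      rw [htop, hw, hv, ENNReal.div_top, tsub_zero, ENNReal.ofReal_zero, add_zero, mul_zero,
        add_zero, one_pow, mul_one, two_eq, ← ENNReal.ofReal_mul zero_le_two,
        ← ENNReal.ofReal_add hR0 hR0']
      refine ENNReal.ofReal_le_ofReal ?_
      linarith
    · obtain ⟨b, hb0, hb⟩ : ∃ b : ℝ, 0 ≤ b ∧ gapMin S 0 = ENNReal.ofReal b :=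
        ⟨_, ENNReal.toReal_nonneg, (ENNReal.ofReal_toReal htop).symm⟩
      have hxb : x < b := by
        rw [hb] at hlt
        exact (ENNReal.ofReal_lt_ofReal_iff_of_nonneg hx0).1 hlt
      have hbpos : 0 < b := hx0.trans_lt hxb
      have h1 : 0 ≤ 1 - x / b := sub_nonneg.2 ((div_le_one hbpos).2 hxb.le)
      have h2 : 0 ≤ b - x := by linarith
      rw [hb, ← ENNReal.ofReal_sub _ hx0, ← ENNReal.ofReal_div_of_pos hbpos, ← ENNReal.ofReal_one,
        ← ENNReal.ofReal_sub _ (by positivity), two_eq, ← ENNReal.ofReal_pow h1,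
        ← ENNReal.ofReal_pow h2, ← ENNReal.ofReal_mul zero_le_two,
        ← ENNReal.ofReal_mul (by positivity), ← ENNReal.ofReal_add hw0 hv0,
        ← ENNReal.ofReal_mul (by positivity), ← ENNReal.ofReal_add hR0 hR0',
        ← ENNReal.ofReal_add (by positivity) (by positivity)]
      exact ENNReal.ofReal_le_ofReal (bound' b hxb hb.ge)
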